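/- Let $\mathbb{K}$ be a field of characteristic $0$ and let $\mathbb{K}[x]=\mathbb{K}[x_0,\ldots,x_n]$ with the standard grading and variables ordered $x_n>\cdots>x_0$. A homogeneous ideal $I\subseteq\mathbb{K}[x]$ is Borel-fixed if it is fixed by every linear change of variables $x_i\mapsto\sum_j g_{ij}x_j$ with $(g_{ij})$ an invertible upper triangular matrix. The saturation of $I$ is $I^{\mathrm{sat}}=\{f : (x_0,\ldots,x_n)^k f\subseteq I \text{ for some } k\ge 0\}$, and $I$ is saturated if $I=I^{\mathrm{sat}}$. The Hilbert polynomial of $I$ is the polynomial $p(t)\in\mathbb{Q}[t]$ with $p(t)=\dim_{\mathbb{K}}\mathbb{K}[x]_t/I_t$ for all $t\gg 0$. The Gotzmann number of $p(t)$ is the number $r\ge 0$ of terms in its Gotzmann decomposition $$p(t)=\binom{t+a_1}{a_1}+\binom{t+a_2-1}{a_2}+\cdots+\binom{t+a_r-(r-1)}{a_r},\qquad a_1\ge a_2\ge\cdots\ge a_r\ge 0.$$ For $r\ge 0$, $\{I_r\}$ denotes the set of monomials of degree $r$ lying in $I$. The Borel order $\le_B$ on monomials of degree $r$ is the reflexive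 and transitive closure of the relations $x^\alpha\le_B \frac{x_{i+1}}{x_i}x^\alpha$ for $0\le i<n$ and $x_i\mid x^\alpha$. **Lemma.** Let $J\subseteq\mathbb{K}[x]$ be a saturated Borel-fixed ideal with Hilbert polynomial $p(t)$, whose Gotzmann number is $r$. Let $x^\beta$ be an element of $\{J_r\}$ that is minimal in $\{J_r\}$ for $\le_B$ and is divisible by $x_0$. Then the ideal $$I=\big\langle \{J_r\}\setminus\{x^\beta\}\big\rangle^{\mathrm{sat}}$$ is Borel-fixed and has Hilbert polynomial $p(t)+1$. -/

import Mathlib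

open MvPolynomial

noncomputable section

attribute [local instance] MvPolynomial.gradedAlgebra

namespace BorelFixed

variable {n : ℕ} {K : Type*} [Field K]

/-- The action of a matrix `g` on the polynomial ring by linear change of variables,
`x_i ↦ ∑ j, g i j * x_j`. -/
def linearChange (g : Matrix (Fin (n + 1)) (Fin (n + 1)) K) :
    MvPolynomial (Fin (n + 1)) K →ₐ[K] MvPolynomial (Fin (n + 1)) K :=
  aeval fun i => ∑ j, C (g i j) * X j

/-- A homogeneous ideal of `K[x_0, …, x_n]` is Borel-fixed if it is fixed by the action of every
invertible upper triangular matrix. Since `g = 1 + E i j` with `i < j` acts by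
`x_i ↦ x_i + x_j`, variables are moved towards variables of larger index: the variables are
ordered as `x_n > … > x_0`. -/
structure IsBorelFixed (I : Ideal (MvPolynomial (Fin (n + 1)) K)) : Prop where
  isHomogeneous : I.IsHomogeneous (homogeneousSubmodule (Fin (n + 1)) K)
  map_eq : ∀ g : Matrix.GeneralLinearGroup (Fin (n + 1)) K,
    (g : Matrix (Fin (n + 1)) (Fin (n + 1)) K).IsUpperTriangular →
      I.map (linearChange (g : Matrix (Fin (n + 1)) (Fin (n + 1)) K)) = I

/-- The saturation `I : (x_0, …, x_n)^∞` of an ideal: the polynomials `f` with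
`(x_0, …, x_n)^k * f ⊆ I` for some `k`. Here `idealOfVars` is the irrelevant ideal
`(x_0, …, x_n)`. -/
def saturation (I : Ideal (MvPolynomial (Fin (n + 1)) K)) :
    Ideal (MvPolynomial (Fin (n + 1)) K) where
  carrier := {f | ∃ k : ℕ, ∀ g ∈ idealOfVars (Fin (n + 1)) K ^ k, g * f ∈ I}
  zero_mem' := ⟨0, fun g _ => by simp⟩
  add_mem' := by
    rintro f₁ f₂ ⟨k₁, h₁⟩ ⟨k₂, h₂⟩
    refine ⟨k₁ + k₂, fun g hg => ?_⟩
    rw [mul_add]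
    exact I.add_mem (h₁ g (Ideal.pow_le_pow_right (Nat.le_add_right _ _) hg))
      (h₂ g (Ideal.pow_le_pow_right (Nat.le_add_left _ _) hg))
  smul_mem' := by
    rintro c f ⟨k, h⟩
    refine ⟨k, fun g hg => ?_⟩
    rw [smul_eq_mul, mul_left_comm]
    exact I.mul_mem_left c (h g hg)

/-- An ideal is saturated if it equals its saturation. -/
def IsSaturated (I : Ideal (MvPolynomial (Fin (n + 1)) K)) : Prop :=
  saturation I = I

/-- The Hilbert function `t ↦ dim_K (K[x]_t / I_t)` of the quotient by `I`, where
`I_t = I ∩ K[x]_t`. -/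
def hilbertFunction (I : Ideal (MvPolynomial (Fin (n + 1)) K)) (t : ℕ) : ℕ :=
  Module.finrank K (homogeneousSubmodule (Fin (n + 1)) K t ⧸
    (I.restrictScalars K).submoduleOf (homogeneousSubmodule (Fin (n + 1)) K t))

/-- `p` is the Hilbert polynomial of (the quotient by) `I`: it agrees with the Hilbert function in
all large degrees. -/
def HasHilbertPolynomial (I : Ideal (MvPolynomial (Fin (n + 1)) K)) (p : Polynomial ℚ) : Prop :=
  ∀ᶠ t : ℕ in Filter.atTop, p.eval (t : ℚ) = (hilbertFunction I t : ℚ)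

/-- `r` is the Gotzmann number of `p`: the number of terms in a decomposition
`p(t) = ∑ i < r, binom(t + a_i - i, a_i)` with `a_0 ≥ a_1 ≥ … ≥ a_{r-1} ≥ 0`. Here
`Polynomial.preHilbertPoly ℚ d k` is the polynomial
`binom(t - k + d, d) = (t - k + 1) ⋯ (t - k + d) / d!`. -/
def IsGotzmannNumber (p : Polynomial ℚ) (r : ℕ) : Prop :=
  ∃ a : Fin r → ℕ, Antitone a ∧ p = ∑ i : Fin r, Polynomial.preHilbertPoly ℚ (a i) (i : ℕ)

/-- The increasing elementary move: `x^γ = (x_{i+1} / x_i) x^α` for some `i < n`, written as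
`x_i x^γ = x_{i+1} x^α`. Equivalently, `x^α` arises from `x^γ` by the decreasing move
`x_i / x_{i+1}`. -/
def IsUpMove (α γ : Fin (n + 1) →₀ ℕ) : Prop :=
  ∃ i : Fin n, γ + Finsupp.single i.castSucc 1 = α + Finsupp.single i.succ 1

/-- The Borel order `x^α ≤_B x^γ` on monomials: the reflexive transitive closure of the
increasing elementary moves. -/
def BorelLE : (Fin (n + 1) →₀ ℕ) → (Fin (n + 1) →₀ ℕ) → Prop :=
  Relation.ReflTransGen IsUpMove

/-- The (exponents of the) monomials of degree `r` lying in `I`. -/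
def monomialsOfDegree (I : Ideal (MvPolynomial (Fin (n + 1)) K)) (r : ℕ) :
    Set (Fin (n + 1) →₀ ℕ) :=
  {α | α.degree = r ∧ monomial α (1 : K) ∈ I}

/-- `x^β` is a minimal element of the set `S` of monomials for the Borel order. -/
def IsBorelMinimal (S : Set (Fin (n + 1) →₀ ℕ)) (β : Fin (n + 1) →₀ ℕ) : Prop :=
  β ∈ S ∧ ∀ α ∈ S, BorelLE α β → α = β

/-- The ideal generated by a set of monomials. -/
def monomialSpan (K : Type*) [Field K] (S : Set (Fin (n + 1) →₀ ℕ)) :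
    Ideal (MvPolynomial (Fin (n + 1)) K) :=
  Ideal.span ((fun α => monomial α (1 : K)) '' S)

end BorelFixed

end

/-!
In characteristic zero a Borel-fixed ideal is a monomial ideal whose set of exponents is strongly
stable, that is, closed under replacing a variable by one of larger index
(`IsBorelFixed.isMonomialIdeal`, `IsBorelFixed.isStronglyStable`); the converse,
`IsMonomialIdeal.isBorelFixed`, holds over every field. Saturations and Hilbert functions of
monomial ideals are read off from the exponents, so that everything becomes a statement on strongly
stable sets.

The main ingredient is Gotzmann's regularity theorem for such a set `A`
(`isGeneratedInDegreeLE_of_eventually_eq_gotzmannSum`): a saturated `A` whose Hilbert polynomial has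
Gotzmann number `r` is generated in degrees `≤ r`. It is proved by induction on the number of
variables. If `A` is saturated, `x_0` is a nonzerodivisor modulo `A`, so the Hilbert function of `A`
sums up that of the slice `x_0 = 0`. The saturation of the slice satisfies the theorem with the
number `r₁ ≤ r` of positive entries of the decomposition. Let `d s` be the number of monomials of
degree `s` added by this saturation. From degree `r₁` on, `d` stays zero once it vanishes, and the
constant term of the Hilbert polynomial leaves room for only `r - r₁` such monomials there; hence
`d s = 0` for `s ≥ r` (`eq_zero_of_eventually_sum_eq_zero`). This bookkeeping needs the lower bound
`gotzmannSum` for the Hilbert function in small degrees, which is carried through the induction.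

Given this, the monomials of degree `r` of `J` other than the minimal `x^β` still form a set closed
under increasing moves, so they generate a strongly stable set. In each degree `t ≥ r` it misses
only the monomial `x_0 ^ (t - r) * x^β` of `J` (`setOf_mem_diff_upperClosure`), and saturating
changes nothing in large degrees (`exists_forall_mem_of_mem_satSet`, by Dickson's lemma). The
Hilbert polynomial therefore grows by `1`.
-/

namespace BorelFixed

/-! ### Strongly stable sets of exponents -/

open Finsupp in
/-- A set of exponents is *strongly stable* if it is closed under multiplication by monomials and
under replacing a variable by one of larger index. -/
structure IsStronglyStable {n : ℕ} (A : Set (Fin n →₀ ℕ)) : Prop where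
  isUpperSet : IsUpperSet A
  exchange : ∀ (m : Fin n →₀ ℕ) (i j : Fin n), i ≤ j → m + single i 1 ∈ A → m + single j 1 ∈ A

/-- The exponents of the saturation of the monomial ideal with exponent set `A`. For `n = 0` there
is no exponent of positive degree, so that the saturation is everything. -/
def satSet {n : ℕ} (A : Set (Fin n →₀ ℕ)) : Set (Fin n →₀ ℕ) :=
  {m | ∃ N : ℕ, ∀ w : Fin n →₀ ℕ, w.degree = N → m + w ∈ A}

/-- The number of monomials of degree `t` outside `A`. -/
noncomputable def countCompl {n : ℕ} (A : Set (Fin n →₀ ℕ)) (t : ℕ) : ℕ :=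
  {m : Fin n →₀ ℕ | m.degree = t ∧ m ∉ A}.ncard

/-- The monomials of `A` not involving the first variable, as monomials in the other variables. -/
def slice {n : ℕ} (A : Set (Fin (n + 1) →₀ ℕ)) : Set (Fin n →₀ ℕ) :=
  {m | m.cons 0 ∈ A}

/-- Each member of `A` of degree `> r` is a multiple of a member of degree one less: as an ideal,
`A` is generated in degrees `≤ r`. -/
def IsGeneratedInDegreeLE {n : ℕ} (A : Set (Fin n →₀ ℕ)) (r : ℕ) : Prop :=
  ∀ t, r ≤ t → ∀ m ∈ A, m.degree = t + 1 → ∃ m' ∈ A, m' ≤ m ∧ m'.degree = t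

/-! ### Saturation of exponent sets -/

section Saturation

variable {n : ℕ} {A : Set (Fin n →₀ ℕ)}

lemma IsGeneratedInDegreeLE.exists_le {r : ℕ} (h : IsGeneratedInDegreeLE A r)
    {m : Fin n →₀ ℕ} (hm : m ∈ A) (hr : r ≤ m.degree) : ∃ u ∈ A, u ≤ m ∧ u.degree = r := by
  induction hk : m.degree - r generalizing m with
  | zero => exact ⟨m, hm, le_rfl, by omega⟩
  | succ k ih =>
    obtain ⟨m', hm', hle, hd⟩ := h (m.degree - 1) (by omega) m hm (by omega)
    obtain ⟨u, hu, hum, hud⟩ := ih hm' (by omega) (by omega)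
    exact ⟨u, hu, hum.trans hle, hud⟩

lemma add_mem_of_le_degree (hA : IsUpperSet A) {m : Fin n →₀ ℕ} {N : ℕ}
    (h : ∀ w : Fin n →₀ ℕ, w.degree = N → m + w ∈ A) {w : Fin n →₀ ℕ} (hw : N ≤ w.degree) :
    m + w ∈ A := by
  obtain ⟨v, hv, hd⟩ := Finsupp.exists_le_degree_eq w N hw
  exact hA (add_le_add_right hv m) (h v hd)

lemma subset_satSet : IsUpperSet A → A ⊆ satSet A :=
  fun hA _ hm => ⟨0, fun _ _ => hA le_self_add hm⟩

lemma isUpperSet_satSet (hA : IsUpperSet A) : IsUpperSet (satSet A) := by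
  rintro m m' hle ⟨N, h⟩
  exact ⟨N, fun w hw => hA (add_le_add_left hle w) (h w hw)⟩

lemma IsStronglyStable.satSet (hA : IsStronglyStable A) : IsStronglyStable (satSet A) where
  isUpperSet := isUpperSet_satSet hA.isUpperSet
  exchange := by
    rintro m i j hij ⟨N, h⟩
    refine ⟨N, fun w hw => ?_⟩
    rw [add_right_comm]
    exact hA.exchange _ i j hij (by rw [add_right_comm]; exact h w hw)

/-- An ideal agrees with its saturation in large degrees; the bound comes from the finitely many
minimal elements of the saturation (Dickson's lemma). -/
lemma exists_forall_mem_of_mem_satSet (hA : IsUpperSet A) :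
    ∃ B : ℕ, ∀ m ∈ satSet A, B ≤ m.degree → m ∈ A := by
  have hpwo : (satSet A).IsPWO := Set.isPWO_of_wellQuasiOrderedLE _
  have hfin : {g | Minimal (· ∈ satSet A) g}.Finite :=
    (setOfPred_minimal_antichain _).finite_of_partiallyWellOrderedOn
      (hpwo.mono fun g hg => hg.prop)
  have hN : ∀ g, ∃ N : ℕ, g ∈ satSet A → ∀ w : Fin n →₀ ℕ, w.degree = N → g + w ∈ A := by
    intro g
    by_cases hg : g ∈ satSet A
    · obtain ⟨N, h⟩ := hg
      exact ⟨N, fun _ => h⟩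
    · exact ⟨0, fun h => absurd h hg⟩
  choose N hN using hN
  obtain ⟨B, hB⟩ := (hfin.image fun g => g.degree + N g).bddAbove
  refine ⟨B, fun m hm hdeg => ?_⟩
  obtain ⟨g, hgm, hg⟩ := hpwo.exists_le_minimal hm
  obtain ⟨w, rfl⟩ := exists_add_of_le hgm
  have hb : g.degree + N g ≤ B := hB ⟨g, hg, rfl⟩
  rw [map_add] at hdeg
  exact add_mem_of_le_degree hA (hN g hg.prop) (by omega)

lemma satSet_satSet_subset (hA : IsUpperSet A) : satSet (satSet A) ⊆ satSet A := by
  rintro m ⟨N, h⟩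
  obtain ⟨B, hB⟩ := exists_forall_mem_of_mem_satSet hA
  refine ⟨max N B, fun w hw => hB _ ?_ (by rw [map_add]; omega)⟩
  exact add_mem_of_le_degree (isUpperSet_satSet hA) h (by omega)

end Saturation

/-! ### Hilbert functions and slices -/

section Count

variable {n : ℕ}

lemma finite_degree_and (t : ℕ) (P : (Fin n →₀ ℕ) → Prop) :
    {m : Fin n →₀ ℕ | m.degree = t ∧ P m}.Finite :=
  (Finsupp.finite_of_degree_eq t).subset fun _ h => h.1

lemma countCompl_eq_add {A B : Set (Fin n →₀ ℕ)} (h : A ⊆ B) (t : ℕ) :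
    countCompl A t = countCompl B t + {m : Fin n →₀ ℕ | m.degree = t ∧ m ∈ B \ A}.ncard := by
  rw [countCompl, countCompl, ← Set.ncard_union_eq _ (finite_degree_and t _)
    (finite_degree_and t _)]
  · congr 1
    ext m
    have := @h m
    simp only [Set.mem_ofPred_eq, Set.mem_union, Set.mem_sdiff]
    tauto
  · rw [Set.disjoint_left]
    rintro m hm hm'
    exact hm.2 hm'.2.1

lemma degree_cons (k : ℕ) (m : Fin n →₀ ℕ) : (m.cons k).degree = k + m.degree := by
  simp [Finsupp.degree_eq_sum, Fin.sum_univ_succ]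

lemma exists_eq_cons_or (m : Fin (n + 1) →₀ ℕ) :
    (∃ m' : Fin n →₀ ℕ, m = m'.cons 0) ∨ ∃ m', m = m' + Finsupp.single 0 1 := by
  by_cases h : m 0 = 0
  · exact Or.inl ⟨m.tail, by rw [← h, Finsupp.cons_tail]⟩
  · refine Or.inr ⟨m - Finsupp.single 0 1, (tsub_add_cancel_of_le ?_).symm⟩
    rw [Finsupp.single_le_iff]
    omega

lemma IsStronglyStable.slice {A : Set (Fin (n + 1) →₀ ℕ)} (hA : IsStronglyStable A) :
    IsStronglyStable (slice A) where
  isUpperSet := by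
    intro m m' hle hm
    refine hA.isUpperSet (fun i => ?_) hm
    induction i using Fin.cases with
    | zero => simp
    | succ i => simpa using hle i
  exchange := by
    have key : ∀ (m : Fin n →₀ ℕ) (i : Fin n),
        (m + Finsupp.single i 1).cons 0 = m.cons 0 + Finsupp.single i.succ 1 := by
      intro m i
      ext k
      induction k using Fin.cases with
      | zero => simp
      | succ k => simp [Finsupp.single_apply]
    intro m i j hij hm
    have := hA.exchange (m.cons 0) i.succ j.succ (Fin.succ_le_succ_iff.2 hij)
    rw [← key, ← key] at this
    exact this hm

lemma mem_of_add_single_zero_mem {A : Set (Fin (n + 1) →₀ ℕ)} (hA : IsStronglyStable A)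
    (hsat : satSet A ⊆ A) {m : Fin (n + 1) →₀ ℕ} (h : m + Finsupp.single 0 1 ∈ A) : m ∈ A := by
  refine hsat ⟨1, fun w hw => ?_⟩
  obtain ⟨i, rfl⟩ : ∃ i, w = Finsupp.single i 1 := by
    have : w ∈ Set.range fun i : Fin (n + 1) => Finsupp.single i 1 := by
      rw [Finsupp.range_single_one]; exact hw
    obtain ⟨i, hi⟩ := this
    exact ⟨i, hi.symm⟩
  exact hA.exchange m 0 i (Fin.zero_le i) h

/-- For a saturated strongly stable `A`, the first variable is a nonzerodivisor modulo `A`, and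
`slice A` is the quotient by it. -/
lemma countCompl_eq_sum_slice {A : Set (Fin (n + 1) →₀ ℕ)} (hA : IsStronglyStable A)
    (hsat : satSet A ⊆ A) (t : ℕ) :
    countCompl A t = ∑ s ∈ Finset.range (t + 1), countCompl (slice A) s := by
  have hinj : Function.Injective fun m : Fin n →₀ ℕ => m.cons 0 := by
    intro m m' h
    exact (Finsupp.cons_injective2 h).2
  have hslice : ∀ t, ((fun m : Fin n →₀ ℕ => m.cons 0) ''
      {m : Fin n →₀ ℕ | m.degree = t ∧ m ∉ slice A}).ncard = countCompl (slice A) t :=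
    fun t => Set.ncard_image_of_injective _ hinj
  induction t with
  | zero =>
    rw [zero_add, Finset.sum_range_one, ← hslice, countCompl]
    congr 1
    ext m
    constructor
    · rintro ⟨hd, hm⟩
      rcases exists_eq_cons_or m with ⟨m', rfl⟩ | ⟨m', rfl⟩
      · exact ⟨m', ⟨by simpa [degree_cons] using hd, hm⟩, rfl⟩
      · simp at hd
    · rintro ⟨m', ⟨hd, hm⟩, rfl⟩
      exact ⟨by simpa [degree_cons] using hd, hm⟩
  | succ t ih =>
    rw [Finset.sum_range_succ, ← ih, ← hslice, countCompl, countCompl,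
      ← Set.ncard_image_of_injective {m : Fin (n + 1) →₀ ℕ | m.degree = t ∧ m ∉ A}
        (add_left_injective (Finsupp.single 0 1)),
      ← Set.ncard_union_eq _ ((finite_degree_and t _).image _) ((finite_degree_and _ _).image _)]
    · congr 1
      ext m
      constructor
      · rintro ⟨hd, hm⟩
        rcases exists_eq_cons_or m with ⟨m', rfl⟩ | ⟨m', rfl⟩
        · exact Or.inr ⟨m', ⟨by simpa [degree_cons] using hd, hm⟩, rfl⟩
        · refine Or.inl ⟨m', ⟨by simpa using hd, fun h => hm ?_⟩, rfl⟩
          exact hA.isUpperSet le_self_add h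
      · rintro (⟨m', ⟨hd, hm⟩, rfl⟩ | ⟨m', ⟨hd, hm⟩, rfl⟩)
        · exact ⟨by simpa using hd, fun h => hm (mem_of_add_single_zero_mem hA hsat h)⟩
        · exact ⟨by simpa [degree_cons] using hd, hm⟩
    · rw [Set.disjoint_left]
      rintro _ ⟨m, -, rfl⟩ ⟨m', -, h⟩
      have := DFunLike.congr_fun h 0
      simp at this

end Count

/-! ### Gotzmann regularity -/

section Gotzmann

/-- The sum `∑ i < r, binom(t - i + a i, a i)`, restricted to the terms with `i ≤ t`. It is the
value at `t` of the polynomial with Gotzmann decomposition `a 0 ≥ … ≥ a (r - 1)` when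
`r ≤ t + 1`, and the right lower bound for the Hilbert function in the smaller degrees. -/
def gotzmannSum (a : ℕ → ℕ) (r t : ℕ) : ℕ :=
  ∑ i ∈ Finset.range r, if i ≤ t then (t - i + a i).choose (a i) else 0

/-- The backward difference of a Gotzmann decomposition lowers all positive `a i` by one; each of
the terms with `a i = 0` contributes a jump by `1` at `t = i`. -/
lemma gotzmannSum_eq_sum (a : ℕ → ℕ) {r₁ r : ℕ} (hr : r₁ ≤ r) (hpos : ∀ i < r₁, 1 ≤ a i)
    (hzero : ∀ i, r₁ ≤ i → i < r → a i = 0) (t : ℕ) :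
    gotzmannSum a r t = ∑ s ∈ Finset.range (t + 1),
      (gotzmannSum (fun i => a i - 1) r₁ s + if r₁ ≤ s ∧ s < r then 1 else 0) := by
  have hsplit : gotzmannSum a r t =
      gotzmannSum a r₁ t + ∑ i ∈ Finset.Ico r₁ r, if i ≤ t then 1 else 0 := by
    rw [gotzmannSum, gotzmannSum, ← Finset.sum_range_add_sum_Ico _ hr]
    congr 1
    refine Finset.sum_congr rfl fun i hi => ?_
    rw [Finset.mem_Ico] at hi
    simp [hzero i hi.1 hi.2]
  rw [hsplit, Finset.sum_add_distrib]
  congr 1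
  · unfold gotzmannSum
    rw [Finset.sum_comm]
    refine Finset.sum_congr rfl fun i hi => ?_
    obtain ⟨b, hb⟩ := Nat.exists_eq_add_of_le' (hpos i (Finset.mem_range.1 hi))
    simp only [hb, Nat.add_sub_cancel]
    rw [← Finset.sum_filter]
    split_ifs with hit
    · have hfilter : (Finset.range (t + 1)).filter (fun s => i ≤ s) = Finset.Ico i (t + 1) := by
        ext s
        simp only [Finset.mem_filter, Finset.mem_Ico, Finset.mem_range]
        omega
      rw [← add_assoc, ← Nat.sum_range_add_choose, hfilter,
        Finset.sum_Ico_eq_sum_range, Nat.sub_add_comm hit]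
      exact Finset.sum_congr rfl fun s _ => by rw [Nat.add_sub_cancel_left]
    · rw [Finset.filter_false_of_mem, Finset.sum_empty]
      intro s hs
      rw [Finset.mem_range] at hs
      omega
  · rw [← Finset.sum_filter, ← Finset.sum_filter]
    congr 1
    ext i
    simp only [Finset.mem_filter, Finset.mem_Ico, Finset.mem_range]
    omega

/-- The numerical step of Gotzmann's regularity theorem. Here `h` measures how far the Hilbert
function of the saturated hyperplane section exceeds its lower bound, and `d` counts the monomials
added by saturating the section. The difference `c t` between the Hilbert function and its lower
bound in degree `t - 1` is the partial sum over `s < t` of `h s + d s` minus the indicator of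
`[r₁, r)`; it must be `0` in the end. From `r₁` on, `d` stays zero once it vanishes, so this forces
`d s = 0` for `s ≥ r`. -/
lemma eq_zero_of_eventually_sum_eq_zero {h d : ℕ → ℕ} {r₁ r : ℕ} (hr : r₁ ≤ r)
    (hh : ∀ s, r₁ ≤ s → h s = 0) (hd : ∀ s, r₁ ≤ s → d s = 0 → d (s + 1) = 0) {c : ℕ → ℤ}
    (hc0 : c 0 = 0)
    (hc : ∀ s, c (s + 1) = c s + h s + d s - if r₁ ≤ s ∧ s < r then 1 else 0)
    (hev : ∀ᶠ t in Filter.atTop, c t = 0) :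
    (∀ s, r ≤ s → d s = 0) ∧ (∀ t, 0 ≤ c t) ∧ ∀ t, r ≤ t → c t = 0 := by
  obtain ⟨T, hT⟩ := Filter.eventually_atTop.1 hev
  have hvanish : ∀ s, r₁ ≤ s → d s = 0 → ∀ t, s ≤ t → d t = 0 := by
    intro s hs h0 t hst
    induction t, hst using Nat.le_induction with
    | base => exact h0
    | succ t hst ih => exact hd t (hs.trans hst) ih
  have hlow : ∀ t, t ≤ r₁ → 0 ≤ c t := by
    intro t
    induction t with
    | zero => intro; rw [hc0]
    | succ t ih =>
      intro ht
      rw [hc, if_neg (by omega)]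
      have := ih (by omega)
      omega
  have hinc : ∀ t, r₁ ≤ t → (∀ s, r₁ ≤ s → s < t → d s ≠ 0) → 0 ≤ c t := by
    intro t ht
    induction t, ht using Nat.le_induction with
    | base => intro; exact hlow _ le_rfl
    | succ t ht ih =>
      intro hs
      have h1 := ih fun s h1 h2 => hs s h1 (h2.trans (Nat.lt_succ_self t))
      have h2 := hs t ht (Nat.lt_succ_self t)
      rw [hc]
      split_ifs <;> omega
  have hr0 : ∀ s, r ≤ s → d s = 0 := by
    by_contra! hcon
    obtain ⟨s, hs, hne⟩ := hcon
    have hne' : ∀ u, r₁ ≤ u → u ≤ r → d u ≠ 0 :=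
      fun u hu hur h0 => hne (hvanish u hu h0 s (hur.trans hs))
    -- `d` is positive on all of `[r₁, r]`, so `c` never drops there and is positive after `r`
    have hmono : ∀ t, r + 1 ≤ t → 0 < c t := by
      intro t ht
      induction t, ht using Nat.le_induction with
      | base =>
        have h1 := hinc r hr fun u hu hur => hne' u hu hur.le
        have h2 := hne' r hr le_rfl
        rw [hc, if_neg (by omega)]
        omega
      | succ t ht ih =>
        rw [hc, if_neg (by omega)]
        omega
    have h1 := hmono (max T (r + 1)) (le_max_right _ _)
    rw [hT _ (le_max_left _ _)] at h1
    exact lt_irrefl _ h1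
  have hend : ∀ t, r ≤ t → c t = 0 := by
    have hconst : ∀ t u, r ≤ t → t ≤ u → c u = c t := by
      intro t u ht htu
      induction u, htu using Nat.le_induction with
      | base => rfl
      | succ u hu ih =>
        rw [hc, ih, if_neg (by omega), hr0 u (by omega), hh u (by omega)]
        simp
    intro t ht
    rw [← hconst t (max t T) ht (le_max_left _ _), hT _ (le_max_right _ _)]
  refine ⟨hr0, fun t => ?_, hend⟩
  rcases le_total r t with htr | htr
  · exact (hend t htr).ge
  rcases le_total t r₁ with ht1 | ht1
  · exact hlow t ht1
  by_cases hall : ∀ s, r₁ ≤ s → s < t → d s ≠ 0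
  · exact hinc t ht1 hall
  · -- from a zero of `d` on, `c` decreases to its final value `0`
    push Not at hall
    obtain ⟨s, hs, hst, h0⟩ := hall
    have hdec : ∀ u, t ≤ u → c u ≤ c t := by
      intro u htu
      induction u, htu using Nat.le_induction with
      | base => rfl
      | succ u hu ih =>
        rw [hc, hvanish s hs h0 u (by omega), hh u (by omega)]
        split_ifs <;> push_cast <;> omega
    rw [← hend r le_rfl]
    exact hdec r htr

lemma exists_positive_initial_segment (a : ℕ → ℕ) (ha : Antitone a) (r : ℕ) :
    ∃ r₁ ≤ r, (∀ i < r₁, 1 ≤ a i) ∧ ∀ i, r₁ ≤ i → i < r → a i = 0 := by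
  induction r with
  | zero => exact ⟨0, le_rfl, by simp, by simp⟩
  | succ r ih =>
    obtain ⟨r₁, hr, hpos, hzero⟩ := ih
    by_cases h : a r = 0
    · refine ⟨r₁, by omega, hpos, fun i hi hir => ?_⟩
      rcases Nat.lt_succ_iff_lt_or_eq.1 hir with h' | rfl
      · exact hzero i hi h'
      · exact h
    · exact ⟨r + 1, le_rfl, fun i hi => (Nat.one_le_iff_ne_zero.2 h).trans (ha (by omega)),
        fun i hi hir => by omega⟩

/-- Gotzmann's regularity theorem for strongly stable sets: if `A` is saturated and its Hilbert
polynomial has a Gotzmann decomposition with `r` terms, then `A` is generated in degrees `≤ r`. The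
statements on the Hilbert function are what the induction on the number of variables needs. -/
theorem isGeneratedInDegreeLE_of_eventually_eq_gotzmannSum {n : ℕ} {A : Set (Fin n →₀ ℕ)}
    (hA : IsStronglyStable A) (hsat : satSet A ⊆ A) {a : ℕ → ℕ} (ha : Antitone a) {r : ℕ}
    (hev : ∀ᶠ t in Filter.atTop, countCompl A t = gotzmannSum a r t) :
    IsGeneratedInDegreeLE A r ∧ (∀ t, gotzmannSum a r t ≤ countCompl A t) ∧
      ∀ t, r ≤ t + 1 → countCompl A t = gotzmannSum a r t := by
  induction n generalizing a r with
  | zero =>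
    have hdeg : ∀ w : Fin 0 →₀ ℕ, w.degree = 0 := fun w => by rw [Subsingleton.elim w 0, map_zero]
    -- no exponent has degree `1`, so saturation makes `A` everything
    have huniv : ∀ m, m ∈ A := fun m => hsat ⟨1, fun w hw => by simp [hdeg] at hw⟩
    have hcount : ∀ t, countCompl A t = 0 := fun t => by simp [countCompl, huniv]
    have hr : r = 0 := by
      by_contra hr
      obtain ⟨t, ht⟩ := hev.exists
      rw [hcount, gotzmannSum, eq_comm, Finset.sum_eq_zero_iff] at ht
      have := ht 0 (Finset.mem_range.2 (Nat.pos_of_ne_zero hr))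
      rw [if_pos (Nat.zero_le t), Nat.choose_eq_zero_iff] at this
      omega
    subst hr
    refine ⟨fun t _ m _ hm => by simp [hdeg] at hm, fun t => by simp [gotzmannSum],
      fun t _ => by simp [gotzmannSum, hcount]⟩
  | succ n ih =>
    -- `r₁` is the number of terms in the decomposition of the difference of the Hilbert polynomial
    obtain ⟨r₁, hr, hpos, hzero⟩ := exists_positive_initial_segment a ha r
    have hS := hA.slice
    have hS' : satSet (satSet (slice A)) ⊆ satSet (slice A) := satSet_satSet_subset hS.isUpperSet
    have hsub : slice A ⊆ satSet (slice A) := subset_satSet hS.isUpperSet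
    set a' : ℕ → ℕ := fun i => a i - 1 with ha'
    -- `d s` counts the monomials of degree `s` that saturating the slice adds
    set d : ℕ → ℕ := fun s => {m : Fin n →₀ ℕ | m.degree = s ∧ m ∈ satSet (slice A) \ slice A}.ncard
      with hd
    have hd0 : ∀ s, d s = 0 ↔ ∀ m ∈ satSet (slice A), m.degree = s → m ∈ slice A := by
      intro s
      rw [hd]
      simp only
      rw [Set.ncard_eq_zero (finite_degree_and s _), Set.eq_empty_iff_forall_notMem]
      simp only [Set.mem_ofPred_eq, Set.mem_sdiff]
      exact forall_congr' fun m => by tauto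
    have hcount : ∀ s, countCompl (slice A) s = countCompl (satSet (slice A)) s + d s :=
      countCompl_eq_add hsub
    have hcA : ∀ t, countCompl A (t + 1) = countCompl A t + countCompl (slice A) (t + 1) := by
      intro t
      rw [countCompl_eq_sum_slice hA hsat, countCompl_eq_sum_slice hA hsat,
        Finset.sum_range_succ _ (t + 1)]
    have hG := gotzmannSum_eq_sum a hr hpos hzero
    obtain ⟨B, hB⟩ := exists_forall_mem_of_mem_satSet hS.isUpperSet
    have hev' : ∀ᶠ t in Filter.atTop,
        countCompl (satSet (slice A)) t = gotzmannSum a' r₁ t := by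
      obtain ⟨T, hT⟩ := Filter.eventually_atTop.1 hev
      refine Filter.eventually_atTop.2 ⟨T + B + r + 1, fun t ht => ?_⟩
      obtain ⟨t, rfl⟩ := Nat.exists_eq_add_of_le' (show 1 ≤ t by omega)
      have h1 := hT (t + 1) (by omega)
      have h2 := hT t (by omega)
      have hdt : d (t + 1) = 0 := (hd0 _).2 fun m hm hdeg => hB m hm (by omega)
      rw [hcA, hcount, hdt, h2, hG t, hG (t + 1), Finset.sum_range_succ _ (t + 1),
        if_neg (by omega), ← ha'] at h1
      omega
    have hanti : Antitone a' := fun i j hij => Nat.sub_le_sub_right (ha hij) 1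
    obtain ⟨hgen, hle, heq⟩ := ih hS.satSet hS' hanti hev'
    have hdiff : ∀ t, (countCompl A t : ℤ) - gotzmannSum a r t =
        ∑ s ∈ Finset.range (t + 1), ((countCompl (slice A) s : ℤ) -
          (gotzmannSum a' r₁ s + if r₁ ≤ s ∧ s < r then 1 else 0 : ℕ)) := by
      intro t
      rw [countCompl_eq_sum_slice hA hsat, hG, Finset.sum_sub_distrib]
      push_cast
      rfl
    obtain ⟨hdr, hc0, hcr⟩ := eq_zero_of_eventually_sum_eq_zero
      (h := fun s => countCompl (satSet (slice A)) s - gotzmannSum a' r₁ s) (d := d)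
      (c := fun t => ∑ s ∈ Finset.range t, ((countCompl (slice A) s : ℤ) -
        (gotzmannSum a' r₁ s + if r₁ ≤ s ∧ s < r then 1 else 0 : ℕ))) hr
      (fun s hs => by simp [heq s (by omega)])
      (fun s hs h0 => by
        rw [hd0] at h0 ⊢
        intro m hm hdeg
        obtain ⟨m', hm', hle', hdeg'⟩ := hgen s hs m hm hdeg
        exact hS.isUpperSet hle' (h0 m' hm' hdeg'))
      (by simp)
      (fun s => by
        have := hle s
        simp only [Finset.sum_range_succ, hcount]
        push_cast [Nat.cast_sub this]
        ring)
      (by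
        obtain ⟨T, hT⟩ := Filter.eventually_atTop.1 hev
        refine Filter.eventually_atTop.2 ⟨T + 1, fun t ht => ?_⟩
        obtain ⟨t, rfl⟩ := Nat.exists_eq_add_of_le' (show 1 ≤ t by omega)
        rw [← hdiff, hT t (by omega), sub_self])
    refine ⟨fun t ht m hm hdeg => ?_, fun t => ?_, fun t ht => ?_⟩
    · rcases exists_eq_cons_or m with ⟨m, rfl⟩ | ⟨m, rfl⟩
      · obtain ⟨m', hm', hle', hdeg'⟩ := hgen t (hr.trans ht) m (hsub hm)
          (by simpa [degree_cons] using hdeg)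
        refine ⟨m'.cons 0, (hd0 t).1 (hdr t ht) m' hm' hdeg', fun i => ?_,
          by simpa [degree_cons] using hdeg'⟩
        induction i using Fin.cases with
        | zero => simp
        | succ i => simpa using hle' i
      · exact ⟨m, mem_of_add_single_zero_mem hA hsat hm, le_self_add, by simpa using hdeg⟩
    · have := hc0 (t + 1)
      simp only [← hdiff] at this
      omega
    · have := hcr (t + 1) ht
      simp only [← hdiff] at this
      omega

end Gotzmann

/-! ### Monomial ideals -/

@[elab_as_elim]
lemma exponent_induction {n : ℕ} {P : (Fin n →₀ ℕ) → Prop} (m : Fin n →₀ ℕ) (zero : P 0)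
    (add_single : ∀ m i, P m → P (m + Finsupp.single i 1)) : P m := by
  induction hk : m.degree generalizing m with
  | zero =>
    rw [Finsupp.degree_eq_zero_iff] at hk
    rwa [hk]
  | succ k ih =>
    obtain ⟨u, hle, hu⟩ := Finsupp.exists_le_degree_eq m k (by omega)
    obtain ⟨w, rfl⟩ := exists_add_of_le hle
    obtain ⟨i, rfl⟩ : w ∈ Set.range fun i => Finsupp.single i 1 := by
      rw [Finsupp.range_single_one]
      rw [map_add] at hk
      exact Nat.add_left_cancel (hk.trans (by rw [hu]))
    exact add_single u i (ih u hu)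

section MonomialIdeal

variable {n : ℕ} {K : Type*} [Field K]

/-- `I` is the monomial ideal whose monomials are those with exponent in `A`. -/
def IsMonomialIdeal (I : Ideal (MvPolynomial (Fin n) K)) (A : Set (Fin n →₀ ℕ)) : Prop :=
  ∀ f, f ∈ I ↔ ∀ α ∈ f.support, α ∈ A

variable {I : Ideal (MvPolynomial (Fin (n + 1)) K)} {A : Set (Fin (n + 1) →₀ ℕ)}

lemma IsMonomialIdeal.monomial_mem_iff (h : IsMonomialIdeal I A) (α : Fin (n + 1) →₀ ℕ) :
    monomial α (1 : K) ∈ I ↔ α ∈ A := by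
  classical
  rw [h, support_monomial, if_neg one_ne_zero]
  simp

lemma IsMonomialIdeal.isUpperSet (h : IsMonomialIdeal I A) : IsUpperSet A := by
  intro α γ hle hα
  rw [← h.monomial_mem_iff] at hα ⊢
  obtain ⟨δ, rfl⟩ := exists_add_of_le hle
  have : monomial (α + δ) (1 : K) = monomial δ 1 * monomial α 1 := by
    rw [monomial_mul, one_mul, add_comm δ α]
  rw [this]
  exact I.mul_mem_left _ hα

lemma isMonomialIdeal_monomialSpan (S : Set (Fin (n + 1) →₀ ℕ)) :
    IsMonomialIdeal (monomialSpan K S) (upperClosure S : Set (Fin (n + 1) →₀ ℕ)) := by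
  intro f
  rw [monomialSpan, mem_ideal_span_monomial_image]
  simp [mem_upperClosure]

lemma IsMonomialIdeal.saturation (h : IsMonomialIdeal I A) :
    IsMonomialIdeal (saturation I) (satSet A) := by
  classical
  intro f
  constructor
  · rintro ⟨k, hk⟩ α hα
    refine ⟨k, fun w hw => ?_⟩
    have hmem := hk (monomial w 1) ((monomial_mem_pow_idealOfVars_iff k w one_ne_zero).2 hw.ge)
    rw [h] at hmem
    refine hmem _ ?_
    rw [mem_support_iff, add_comm α w, coeff_monomial_mul, one_mul]
    exact mem_support_iff.1 hα
  · intro hf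
    rw [f.as_sum]
    refine Ideal.sum_mem _ fun α hα => ?_
    obtain ⟨N, hN⟩ := hf α hα
    refine ⟨N, fun g hg => (h _).2 fun γ hγ => ?_⟩
    have hγ' := mem_support_iff.1 hγ
    rw [coeff_mul_monomial'] at hγ'
    have hle : α ≤ γ := by
      by_contra hle
      exact hγ' (if_neg hle)
    rw [if_pos hle] at hγ'
    have hdeg := (mem_pow_idealOfVars_iff N g).1 hg (γ - α)
      (mem_support_iff.2 (left_ne_zero_of_mul hγ'))
    have := add_mem_of_le_degree h.isUpperSet hN hdeg
    rwa [add_tsub_cancel_of_le hle] at this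

lemma IsMonomialIdeal.eq_span (h : IsMonomialIdeal I A) :
    I = Ideal.span ((fun α => monomial α (1 : K)) '' A) := by
  ext f
  rw [h, mem_ideal_span_monomial_image]
  exact forall₂_congr fun α _ =>
    ⟨fun hα => ⟨α, hα, le_rfl⟩, fun ⟨γ, hγ, hle⟩ => h.isUpperSet hle hγ⟩

/-- The monomials outside a monomial ideal form a basis of the quotient. -/
lemma IsMonomialIdeal.hilbertFunction_eq (h : IsMonomialIdeal I A) (t : ℕ) :
    hilbertFunction I t = countCompl A t := by
  classical
  let T := {m : Fin (n + 1) →₀ ℕ // m.degree = t ∧ m ∉ A}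
  have hfin : Finite T := (finite_degree_and t _).to_subtype
  let φ : homogeneousSubmodule (Fin (n + 1)) K t →ₗ[K] (T → K) :=
    LinearMap.pi fun m => (lcoeff K m.1).comp (Submodule.subtype _)
  have hφ : ∀ f m, φ f m = coeff m.1 f.1 := fun f m => rfl
  have hker : LinearMap.ker φ =
      (I.restrictScalars K).submoduleOf (homogeneousSubmodule (Fin (n + 1)) K t) := by
    ext f
    rw [LinearMap.mem_ker, Submodule.submoduleOf, Submodule.mem_comap, Submodule.subtype_apply,
      Submodule.restrictScalars_mem, h]
    constructor
    · intro hf α hα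
      by_contra hαA
      have hdeg : α.degree = t := by
        have := f.2 (mem_support_iff.1 hα)
        rw [Finsupp.degree_eq_weight_one]
        exact this
      exact mem_support_iff.1 hα (congrFun hf ⟨α, hdeg, hαA⟩)
    · intro hf
      funext m
      rw [hφ]
      by_contra hne
      exact m.2.2 (hf _ (mem_support_iff.2 hne))
  have hsurj : Function.Surjective φ := by
    have := Fintype.ofFinite T
    intro c
    refine ⟨∑ m : T, c m • ⟨monomial m.1 1, isHomogeneous_monomial 1 m.2.1⟩, ?_⟩
    funext m
    rw [hφ]
    simp only [AddSubmonoidClass.coe_finsetSum, Submodule.coe_smul, coeff_sum, coeff_smul,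
      coeff_monomial, smul_eq_mul]
    rw [Finset.sum_eq_single m]
    · simp
    · intro m' _ hne
      rw [if_neg (fun he => hne (Subtype.ext he)), mul_zero]
    · intro hm
      exact absurd (Finset.mem_univ m) hm
  have := Fintype.ofFinite T
  rw [hilbertFunction, ← hker, (φ.quotKerEquivOfSurjective hsurj).finrank_eq,
    Module.finrank_fintype_fun_eq_card, ← Nat.card_eq_fintype_card]
  exact Nat.card_coe_set_eq {m : Fin (n + 1) →₀ ℕ | m.degree = t ∧ m ∉ A}

end MonomialIdeal

/-! ### Borel-fixed ideals and strongly stable sets -/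

section Borel

attribute [local instance] MvPolynomial.gradedAlgebra

variable {n : ℕ} {K : Type*} [Field K]

lemma linearChange_comp (g h : Matrix (Fin (n + 1)) (Fin (n + 1)) K) :
    (linearChange g).comp (linearChange h) = linearChange (h * g) := by
  refine algHom_ext fun i => ?_
  simp only [AlgHom.comp_apply, linearChange, aeval_X, map_sum, map_mul, algHom_C,
    Matrix.mul_apply, Finset.mul_sum, Finset.sum_mul]
  rw [Finset.sum_comm]
  refine Finset.sum_congr rfl fun j _ => Finset.sum_congr rfl fun k _ => ?_
  simp [mul_assoc]

lemma linearChange_one :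
    linearChange (1 : Matrix (Fin (n + 1)) (Fin (n + 1)) K) = AlgHom.id K _ := by
  refine algHom_ext fun i => ?_
  simp [linearChange, Matrix.one_apply]

lemma linearChange_diagonal_monomial (d : Fin (n + 1) → K) (α : Fin (n + 1) →₀ ℕ) (c : K) :
    linearChange (Matrix.diagonal d) (monomial α c) = monomial α ((∏ i, d i ^ α i) * c) := by
  have hX : ∀ i, ∑ j, C (Matrix.diagonal d i j) * X j = C (d i) * (X i : MvPolynomial _ K) := by
    intro i
    rw [Finset.sum_eq_single i]
    · simp
    · intro j _ hj
      simp [Matrix.diagonal_apply_ne' _ hj]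
    · simp
  rw [linearChange, aeval_monomial, Finsupp.prod_fintype _ _ (by simp)]
  simp only [hX, mul_pow, Finset.prod_mul_distrib]
  rw [monomial_eq, Finsupp.prod_fintype _ _ (by simp), map_mul, map_prod]
  simp only [map_pow, algebraMap_eq]
  ring

lemma IsMonomialIdeal.map_linearChange_le {I : Ideal (MvPolynomial (Fin (n + 1)) K)}
    {A : Set (Fin (n + 1) →₀ ℕ)} (h : IsMonomialIdeal I A) (hA : IsStronglyStable A)
    {g : Matrix (Fin (n + 1)) (Fin (n + 1)) K} (hg : g.IsUpperTriangular) :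
    I.map (linearChange g) ≤ I := by
  -- The variables of a monomial of `A` can be substituted one at a time.
  have key : ∀ m w : Fin (n + 1) →₀ ℕ, w + m ∈ A →
      monomial w 1 * linearChange g (monomial m 1) ∈ I := by
    intro m
    induction m using exponent_induction with
    | zero =>
      intro w hw
      rw [add_zero] at hw
      have h1 : monomial (0 : Fin (n + 1) →₀ ℕ) (1 : K) = 1 := rfl
      rw [h1, map_one (linearChange g), mul_one]
      exact (h.monomial_mem_iff w).2 hw
    | add_single m i ih =>
      intro w hw
      have hX : monomial (m + Finsupp.single i 1) (1 : K) = monomial m 1 * X i := by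
        rw [X, monomial_mul, one_mul]
      have hexp : monomial w 1 * linearChange g (monomial (m + Finsupp.single i 1) 1) =
          ∑ j, C (g i j) *
            (monomial (w + Finsupp.single j 1) 1 * linearChange g (monomial m 1)) := by
        have hi : linearChange g (X i) = ∑ j, C (g i j) * X j := by rw [linearChange, aeval_X]
        rw [hX, map_mul, hi, Finset.mul_sum, Finset.mul_sum]
        refine Finset.sum_congr rfl fun j _ => ?_
        rw [monomial_add_single, pow_one]
        ring
      rw [hexp]
      refine Ideal.sum_mem _ fun j _ => ?_
      rcases lt_or_ge j i with hji | hij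
      · rw [hg hji, C_0, zero_mul]
        exact I.zero_mem
      · refine I.mul_mem_left _ (ih _ ?_)
        rw [add_right_comm]
        refine hA.exchange _ i j hij ?_
        rwa [add_assoc]
  nth_rw 1 [h.eq_span]
  rw [Ideal.map_span, Ideal.span_le]
  rintro _ ⟨_, ⟨α, hα, rfl⟩, rfl⟩
  have := key α 0 (by rwa [zero_add])
  rwa [← C_apply, C_1, one_mul] at this

/-- Invariance holds with equality because the inverse matrix is upper triangular as well. -/
lemma IsMonomialIdeal.isBorelFixed {I : Ideal (MvPolynomial (Fin (n + 1)) K)}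
    {A : Set (Fin (n + 1) →₀ ℕ)} (h : IsMonomialIdeal I A) (hA : IsStronglyStable A) :
    IsBorelFixed I where
  isHomogeneous := by
    rw [h.eq_span]
    refine Ideal.homogeneous_span _ _ ?_
    rintro _ ⟨α, -, rfl⟩
    exact ⟨α.degree, isHomogeneous_monomial 1 rfl⟩
  map_eq g hg := by
    refine le_antisymm (h.map_linearChange_le hA hg) ?_
    have hinv : ((g⁻¹ : Matrix.GeneralLinearGroup (Fin (n + 1)) K) :
        Matrix (Fin (n + 1)) (Fin (n + 1)) K).IsUpperTriangular := by
      have := g.invertible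
      rw [Matrix.coe_units_inv]
      exact Matrix.blockTriangular_inv_of_blockTriangular hg
    have hle := Ideal.map_mono (f := linearChange (g : Matrix (Fin (n + 1)) (Fin (n + 1)) K))
      (h.map_linearChange_le hA hinv)
    rw [Ideal.map_mapₐ, linearChange_comp, ← Units.val_mul, inv_mul_cancel, Units.val_one,
      linearChange_one] at hle
    simpa using hle

variable {J : Ideal (MvPolynomial (Fin (n + 1)) K)}

lemma IsBorelFixed.linearChange_mem (hJ : IsBorelFixed J)
    {g : Matrix (Fin (n + 1)) (Fin (n + 1)) K} (hg : g.IsUpperTriangular) (hdet : g.det ≠ 0)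
    {f : MvPolynomial (Fin (n + 1)) K} (hf : f ∈ J) : linearChange g f ∈ J := by
  have := hJ.map_eq (Matrix.GeneralLinearGroup.mkOfDetNeZero g hdet) hg
  rw [← this]
  exact Ideal.mem_map_of_mem _ hf

/-- In characteristic zero, invariance under diagonal matrices forces an ideal to be monomial: two
monomials of `f` differing in the exponent of `x_i` are separated by the scaling `x_i ↦ 2 x_i`. -/
lemma IsBorelFixed.monomial_mem [CharZero K] (hJ : IsBorelFixed J)
    {f : MvPolynomial (Fin (n + 1)) K} (hf : f ∈ J) {γ : Fin (n + 1) →₀ ℕ} (hγ : γ ∈ f.support) :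
    monomial γ (1 : K) ∈ J := by
  classical
  induction hk : f.support.card using Nat.strong_induction_on generalizing f with
  | _ k ih =>
    subst hk
    by_cases hex : ∃ α ∈ f.support, α ≠ γ
    · obtain ⟨α, hα, hne⟩ := hex
      obtain ⟨i, hi⟩ := DFunLike.ne_iff.1 hne
      set d : Fin (n + 1) → K := Function.update 1 i 2 with hd
      have hprod : ∀ δ : Fin (n + 1) →₀ ℕ, ∏ j, d j ^ δ j = 2 ^ δ i := by
        intro δ
        rw [Finset.prod_eq_single i]
        · simp [hd]
        · intro j _ hj
          simp [hd, hj]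
        · simp
      have hmem : linearChange (Matrix.diagonal d) f ∈ J := by
        refine hJ.linearChange_mem (Matrix.blockTriangular_diagonal d) ?_ hf
        rw [Matrix.det_diagonal]
        have := hprod (Finsupp.equivFunOnFinite.symm 1)
        simp only [Finsupp.equivFunOnFinite_symm_apply_apply, Pi.one_apply, pow_one] at this
        rw [this]
        exact two_ne_zero
      have hcoeff : ∀ δ, coeff δ (linearChange (Matrix.diagonal d) f - C (2 ^ α i) * f) =
          (2 ^ δ i - 2 ^ α i) * coeff δ f := by
        intro δ
        have : coeff δ (linearChange (Matrix.diagonal d) f) = 2 ^ δ i * coeff δ f := by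
          conv_lhs => rw [f.as_sum]
          simp only [map_sum, linearChange_diagonal_monomial, hprod, coeff_sum, coeff_monomial]
          rw [Finset.sum_ite_eq']
          split_ifs with hδ
          · rfl
          · rw [notMem_support_iff.1 hδ, mul_zero]
        rw [coeff_sub, this, coeff_C_mul, sub_mul]
      have hsupp : (linearChange (Matrix.diagonal d) f - C (2 ^ α i) * f).support ⊂ f.support := by
        refine Finset.ssubset_iff_of_subset (fun δ hδ => ?_) |>.2 ⟨α, hα, ?_⟩
        · rw [mem_support_iff, hcoeff] at hδ
          exact mem_support_iff.2 (right_ne_zero_of_mul hδ)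
        · rw [notMem_support_iff, hcoeff, sub_self, zero_mul]
      refine ih _ (Finset.card_lt_card hsupp) (J.sub_mem hmem (J.mul_mem_left _ hf)) ?_ rfl
      rw [mem_support_iff, hcoeff]
      refine mul_ne_zero (fun h => hi ?_) (mem_support_iff.1 hγ)
      have h2 : ((2 ^ γ i : ℕ) : K) = ((2 ^ α i : ℕ) : K) := by
        push_cast
        exact sub_eq_zero.1 h
      exact (Nat.pow_right_injective le_rfl (Nat.cast_injective h2)).symm
    · push Not at hex
      have hf' : f = monomial γ (coeff γ f) := by
        ext δ
        rw [coeff_monomial]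
        split_ifs with hδ
        · rw [hδ]
        · by_contra hne
          exact hδ (hex δ (mem_support_iff.2 hne)).symm
      have hmul : monomial γ (1 : K) = C (coeff γ f)⁻¹ * f := by
        rw [hf', C_mul_monomial, coeff_monomial, if_pos rfl,
          inv_mul_cancel₀ (mem_support_iff.1 hγ)]
      rw [hmul]
      exact J.mul_mem_left _ hf

lemma IsBorelFixed.isMonomialIdeal [CharZero K] (hJ : IsBorelFixed J) :
    IsMonomialIdeal J {α | monomial α (1 : K) ∈ J} := by
  intro f
  refine ⟨fun hf α hα => hJ.monomial_mem hf hα, fun hf => ?_⟩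
  rw [f.as_sum]
  refine Ideal.sum_mem _ fun α hα => ?_
  rw [← mul_one (coeff α f), ← C_mul_monomial]
  exact J.mul_mem_left _ (hf α hα)

/-- The substitution `x_i ↦ x_i + x_j` turns `x_i ^ (k + 1)` into a polynomial in which the
coefficient of `x_i ^ k * x_j` is `k + 1`, which does not vanish in characteristic zero. -/
lemma IsBorelFixed.isStronglyStable [CharZero K] (hJ : IsBorelFixed J) :
    IsStronglyStable {α | monomial α (1 : K) ∈ J} where
  isUpperSet := hJ.isMonomialIdeal.isUpperSet
  exchange := by
    classical
    intro m i j hij hm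
    rcases hij.eq_or_lt with rfl | hij
    · exact hm
    have hne : i ≠ j := hij.ne
    set g : Matrix (Fin (n + 1)) (Fin (n + 1)) K := Matrix.transvection i j 1 with hg
    have hgX : ∀ l, linearChange g (X l) = X l + if l = i then X j else 0 := by
      intro l
      rw [linearChange, aeval_X]
      simp only [hg, Matrix.transvection, Matrix.add_apply, map_add, add_mul,
        Finset.sum_add_distrib]
      congr 1
      · simp [Matrix.one_apply]
      · split_ifs with hl
        · subst hl
          simp [Matrix.single_apply]
        · simp [Ne.symm hl]
    have hmem : linearChange g (monomial (m + Finsupp.single i 1) 1) ∈ J := by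
      refine hJ.linearChange_mem ?_ ?_ hm
      · exact (Matrix.blockTriangular_transvection hij.le 1)
      · rw [hg, Matrix.det_transvection_of_ne i j hne]
        exact one_ne_zero
    refine hJ.monomial_mem hmem ?_
    rw [mem_support_iff]
    -- `e` is the part of `m` without `x_i`, which the substitution fixes
    set e := m.erase i with he
    have hme : m = e + Finsupp.single i (m i) := by rw [he, Finsupp.erase_add_single]
    have hfix : linearChange g (monomial e 1) = monomial e (1 : K) := by
      rw [linearChange, aeval_monomial, map_one, one_mul, monomial_eq, C_1, one_mul]
      refine Finset.prod_congr rfl fun l hl => ?_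
      have := hgX l
      rw [linearChange, aeval_X, if_neg, add_zero] at this
      · simp only [this]
      · rintro rfl
        simp [he] at hl
    have hsplit : monomial (m + Finsupp.single i 1) (1 : K) = X i ^ (m i + 1) * monomial e 1 := by
      rw [X_pow_eq_monomial, monomial_mul, one_mul]
      congr 2
      nth_rw 1 [hme]
      rw [Finsupp.single_add]
      abel
    obtain ⟨q, hq⟩ :=
      Polynomial.powAddExpansion (X i : MvPolynomial (Fin (n + 1)) K) (X j) (m i + 1)
    have hexp : linearChange g (monomial (m + Finsupp.single i 1) 1) =
        monomial (m + Finsupp.single i 1) 1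
          + C ((m i + 1 : ℕ) : K) * monomial (m + Finsupp.single j 1) 1
          + q * monomial (e + Finsupp.single j 2) 1 := by
      have h1 : (X i ^ m i * X j * monomial e 1 : MvPolynomial (Fin (n + 1)) K) =
          monomial (m + Finsupp.single j 1) 1 := by
        rw [X_pow_eq_monomial, X, monomial_mul, monomial_mul, one_mul, one_mul]
        congr 2
        nth_rw 2 [hme]
        abel
      have h2 : (X j ^ 2 * monomial e 1 : MvPolynomial (Fin (n + 1)) K) =
          monomial (e + Finsupp.single j 2) 1 := by
        rw [X_pow_eq_monomial, monomial_mul, one_mul, add_comm e]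
      rw [hsplit, map_mul, map_pow, hgX, if_pos rfl, hfix, hq, ← h1, ← h2, Nat.add_sub_cancel,
        map_natCast]
      ring
    have hj : ∀ k : ℕ, (e + Finsupp.single j k) j = m j + k := by
      intro k
      simp [he, hne.symm]
    rw [hexp, coeff_add, coeff_add, coeff_monomial, coeff_C_mul, coeff_monomial, if_pos rfl,
      coeff_mul_monomial', if_neg, if_neg, zero_add, add_zero, mul_one]
    · exact Nat.cast_ne_zero.2 (Nat.succ_ne_zero _)
    · intro hle
      have := hle j
      rw [hj] at this
      simp at this
    · intro heq
      have := DFunLike.congr_fun heq j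
      simp [hne] at this

end Borel

/-! ### The Borel order -/

section BorelOrder

variable {n : ℕ}

lemma borelLE_add_single (m : Fin (n + 1) →₀ ℕ) {i j : Fin (n + 1)} (hij : i ≤ j) :
    BorelLE (m + Finsupp.single i 1) (m + Finsupp.single j 1) := by
  induction j using Fin.induction with
  | zero =>
    rw [Fin.le_zero_iff.1 hij]
    exact Relation.ReflTransGen.refl
  | succ j ih =>
    rcases hij.eq_or_lt with rfl | hlt
    · exact Relation.ReflTransGen.refl
    · refine (ih (Fin.le_castSucc_iff.2 hlt)).tail ⟨j, ?_⟩
      abel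

/-- Degree-preserving replacement of a power of `x_0` by any monomial goes up in the Borel order. -/
lemma borelLE_add (w m : Fin (n + 1) →₀ ℕ) :
    BorelLE (m + Finsupp.single 0 w.degree) (m + w) := by
  induction w using exponent_induction generalizing m with
  | zero =>
    rw [map_zero, Finsupp.single_zero]
    exact Relation.ReflTransGen.refl
  | add_single w i ih =>
    have h1 := ih (m + Finsupp.single 0 1)
    rw [add_right_comm m _ w] at h1
    have h := h1.trans (borelLE_add_single (m + w) (Fin.zero_le i))
    rwa [map_add, Finsupp.degree_single, Finsupp.single_add, ← add_assoc m w,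
      add_comm (Finsupp.single 0 w.degree), ← add_assoc]

lemma borelLE_of_le_add_single_zero {u β : Fin (n + 1) →₀ ℕ} {k : ℕ}
    (hle : u ≤ β + Finsupp.single 0 k) (hdeg : u.degree = β.degree) : BorelLE u β := by
  have hu : u = u ⊓ β + Finsupp.single 0 (u 0 - β 0) := by
    ext i
    rw [Finsupp.add_apply, Finsupp.inf_apply]
    induction i using Fin.cases with
    | zero =>
      rw [Finsupp.single_eq_same]
      omega
    | succ i =>
      have := hle i.succ
      simp only [Finsupp.add_apply, Finsupp.single_apply, (Fin.succ_ne_zero i).symm,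
        if_false, add_zero] at this ⊢
      omega
  have hβ : β = u ⊓ β + (β - u) := by
    ext i
    rw [Finsupp.add_apply, Finsupp.inf_apply, Finsupp.tsub_apply]
    omega
  have hk : u 0 - β 0 = (β - u).degree := by
    have h1 := congrArg Finsupp.degree hu
    have h2 := congrArg Finsupp.degree hβ
    rw [map_add, Finsupp.degree_single] at h1
    rw [map_add] at h2
    omega
  have := borelLE_add (β - u) (u ⊓ β)
  rwa [← hk, ← hu, ← hβ] at this

end BorelOrder

/-! ### Removing a Borel-minimal generator -/

section RemoveMinimal

variable {n : ℕ} {A S : Set (Fin (n + 1) →₀ ℕ)} {β : Fin (n + 1) →₀ ℕ} {r : ℕ}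

lemma isStronglyStable_upperClosure
    (hS : ∀ m i j, i ≤ j → m + Finsupp.single i 1 ∈ S → m + Finsupp.single j 1 ∈ S) :
    IsStronglyStable (upperClosure S : Set (Fin (n + 1) →₀ ℕ)) where
  isUpperSet := (upperClosure S).upper
  exchange := by
    rintro m i j hij ⟨s, hs, hle⟩
    by_cases h : s ≤ m
    · exact ⟨s, hs, h.trans le_self_add⟩
    · have hi : 1 ≤ s i := by
        by_contra hi
        refine h fun k => ?_
        have := hle k
        rw [Finsupp.add_apply] at this
        rcases eq_or_ne k i with rfl | hk
        · omega
        · rwa [Finsupp.single_eq_of_ne hk, add_zero] at this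
      obtain ⟨s, rfl⟩ : ∃ s', s = s' + Finsupp.single i 1 :=
        ⟨s - Finsupp.single i 1, (tsub_add_cancel_of_le (by rwa [Finsupp.single_le_iff])).symm⟩
      exact ⟨_, hS s i j hij hs, add_le_add_left (le_of_add_le_add_right hle) _⟩

/-- Removing a Borel-minimal monomial `β` of degree `r` from the generators loses, in a strongly
stable set generated in degrees `≤ r`, exactly one monomial in each degree `t ≥ r`, namely
`x_0 ^ (t - r) * x ^ β`: any other multiple of `x ^ β` is also a multiple of an exchange
`(x_i / x_0) * x ^ β`. -/
lemma setOf_mem_diff_upperClosure (hA : IsStronglyStable A) (hgen : IsGeneratedInDegreeLE A r)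
    (hβ : IsBorelMinimal {α | α.degree = r ∧ α ∈ A} β) (hβ0 : β 0 ≠ 0) {t : ℕ} (ht : r ≤ t) :
    {m | m.degree = t ∧ m ∈ A \ (upperClosure ({α | α.degree = r ∧ α ∈ A} \ {β}) :
      Set (Fin (n + 1) →₀ ℕ))} = {β + Finsupp.single 0 (t - r)} := by
  obtain ⟨⟨hβr, hβA⟩, hmin⟩ := hβ
  ext m
  constructor
  · rintro ⟨hdeg, hm, hm'⟩
    -- `β` is the only member of `A` of degree `r` dividing `m`.
    have hall : ∀ u ∈ A, u.degree = r → u ≤ m → u = β := by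
      intro u hu hd hle
      by_contra hne
      exact hm' ⟨u, ⟨⟨hd, hu⟩, hne⟩, hle⟩
    obtain ⟨u, hu, hle, hud⟩ := hgen.exists_le hm (by omega)
    obtain rfl := hall u hu hud hle
    obtain ⟨w, rfl⟩ := exists_add_of_le hle
    have hw : w = Finsupp.single 0 (w 0) := by
      ext i
      rcases eq_or_ne i 0 with rfl | hi
      · simp
      rw [Finsupp.single_eq_of_ne hi]
      by_contra hwi
      obtain ⟨v, rfl⟩ : ∃ v, u = v + Finsupp.single 0 1 :=
        ⟨u - Finsupp.single 0 1, (tsub_add_cancel_of_le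
          (by rw [Finsupp.single_le_iff]; omega)).symm⟩
      have heq := hall (v + Finsupp.single i 1) (hA.exchange v 0 i (Fin.zero_le i) hu)
        (by simpa using hud)
        (add_le_add le_self_add (by rw [Finsupp.single_le_iff]; omega))
      have := DFunLike.congr_fun heq i
      simp [hi.symm] at this
    have hd : (u + w).degree = r + w 0 := by
      rw [map_add, hud, hw, Finsupp.degree_single, Finsupp.single_eq_same]
    have : w 0 = t - r := by omega
    rw [Set.mem_singleton_iff, ← this, ← hw]
  · rintro rfl
    refine ⟨by rw [map_add, hβr, Finsupp.degree_single]; omega,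
      hA.isUpperSet le_self_add hβA, ?_⟩
    rintro ⟨u, ⟨⟨hud, hu⟩, hne⟩, hle⟩
    exact hne (hmin u ⟨hud, hu⟩ (borelLE_of_le_add_single_zero hle (hud.trans hβr.symm)))

end RemoveMinimal

/-! ### Hilbert polynomials -/

lemma eventually_countCompl_satSet_eq {n : ℕ} {A : Set (Fin n →₀ ℕ)} (hA : IsUpperSet A) :
    ∀ᶠ t in Filter.atTop, countCompl (satSet A) t = countCompl A t := by
  obtain ⟨B, hB⟩ := exists_forall_mem_of_mem_satSet hA
  refine Filter.eventually_atTop.2 ⟨B, fun t ht => ?_⟩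
  rw [countCompl_eq_add (subset_satSet hA), (Set.ncard_eq_zero (finite_degree_and t _)).2,
    add_zero]
  rw [Set.eq_empty_iff_forall_notMem]
  rintro m ⟨hd, hm, hm'⟩
  exact hm' (hB m hm (by omega))

lemma exists_eventually_eval_eq_gotzmannSum {p : Polynomial ℚ} {r : ℕ}
    (hr : IsGotzmannNumber p r) :
    ∃ a : ℕ → ℕ, Antitone a ∧ ∀ t, r ≤ t → p.eval (t : ℚ) = gotzmannSum a r t := by
  obtain ⟨a, ha, rfl⟩ := hr
  refine ⟨fun i => if h : i < r then a ⟨i, h⟩ else 0, fun i j hij => ?_, fun t ht => ?_⟩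
  · by_cases hj : j < r
    · simp only [hj, hij.trans_lt hj, dif_pos]
      exact ha hij
    · simp [hj]
  · rw [gotzmannSum, Finset.sum_range, Polynomial.eval_finsetSum]
    push_cast
    refine Finset.sum_congr rfl fun i _ => ?_
    have hit : (i : ℕ) ≤ t := i.2.le.trans ht
    rw [Polynomial.preHilbertPoly_eq_choose_sub_add ℚ _ hit]
    simp [hit]

end BorelFixed

theorem mainTheorem2 {K : Type*} [Field K] [CharZero K] (n : ℕ)
    (J : Ideal (MvPolynomial (Fin (n + 1)) K))
    (hJ : BorelFixed.IsBorelFixed J) (hsat : BorelFixed.IsSaturated J)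
    (p : Polynomial ℚ) (hp : BorelFixed.HasHilbertPolynomial J p)
    (r : ℕ) (hr : BorelFixed.IsGotzmannNumber p r)
    (β : Fin (n + 1) →₀ ℕ)
    (hβ : BorelFixed.IsBorelMinimal (BorelFixed.monomialsOfDegree J r) β)
    (hβ0 : (X 0 : MvPolynomial (Fin (n + 1)) K) ∣ monomial β 1) :
    BorelFixed.IsBorelFixed
        (BorelFixed.saturation
          (BorelFixed.monomialSpan K (BorelFixed.monomialsOfDegree J r \ {β}))) ∧
      BorelFixed.HasHilbertPolynomial
        (BorelFixed.saturation
          (BorelFixed.monomialSpan K (BorelFixed.monomialsOfDegree J r \ {β})))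
        (p + 1) := by
  classical
  open BorelFixed in
  set A : Set (Fin (n + 1) →₀ ℕ) := {α | monomial α (1 : K) ∈ J} with hAdef
  have hmono : IsMonomialIdeal J A := hJ.isMonomialIdeal
  have hA : IsStronglyStable A := hJ.isStronglyStable
  have hsatA : satSet A ⊆ A := by
    intro α hα
    have h : IsMonomialIdeal J (satSet A) := by
      have := hmono.saturation
      rwa [hsat] at this
    exact (h.monomial_mem_iff α).2 hα
  have hβ0' : β 0 ≠ 0 := by
    rw [X_dvd_monomial] at hβ0
    exact hβ0.resolve_left one_ne_zero
  obtain ⟨a, ha, hpa⟩ := exists_eventually_eval_eq_gotzmannSum hr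
  have hev : ∀ᶠ t in Filter.atTop, countCompl A t = gotzmannSum a r t := by
    filter_upwards [hp, Filter.eventually_ge_atTop r] with t ht htr
    rw [hpa t htr, hmono.hilbertFunction_eq] at ht
    exact_mod_cast ht.symm
  have hgen := (isGeneratedInDegreeLE_of_eventually_eq_gotzmannSum hA hsatA ha hev).1
  set S : Set (Fin (n + 1) →₀ ℕ) := monomialsOfDegree J r \ {β} with hS
  have hmono' : IsMonomialIdeal (monomialSpan K S) (upperClosure S : Set (Fin (n + 1) →₀ ℕ)) :=
    isMonomialIdeal_monomialSpan S
  have hA' : IsStronglyStable (upperClosure S : Set (Fin (n + 1) →₀ ℕ)) := by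
    refine isStronglyStable_upperClosure ?_
    rintro m i j hij ⟨⟨hd, hm⟩, hne⟩
    refine ⟨⟨by simpa using hd, hA.exchange m i j hij hm⟩, fun heq => hne ?_⟩
    refine hβ.2 _ ⟨hd, hm⟩ ?_
    rw [← Set.mem_singleton_iff.1 heq]
    exact borelLE_add_single m hij
  have hsub : (upperClosure S : Set (Fin (n + 1) →₀ ℕ)) ⊆ A :=
    fun m ⟨s, hs, hle⟩ => hA.isUpperSet hle hs.1.2
  refine ⟨hmono'.saturation.isBorelFixed hA'.satSet, ?_⟩
  filter_upwards [hp, eventually_countCompl_satSet_eq hA'.isUpperSet,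
    Filter.eventually_ge_atTop r] with t hpt hct htr
  rw [hmono'.saturation.hilbertFunction_eq, hct, countCompl_eq_add hsub,
    show S = {α | α.degree = r ∧ α ∈ A} \ {β} from rfl,
    setOf_mem_diff_upperClosure hA hgen hβ hβ0' htr, Set.ncard_singleton,
    ← hmono.hilbertFunction_eq, Polynomial.eval_add, Polynomial.eval_one, hpt]
  push_cast
  rfl
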